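/- Let $X$ be a real Banach space with topological dual $X^*$, and let $\langle x,x^*\rangle=x^*(x)$ be the duality product on $X\times X^*$. A function $h:X\times X^*\to[-\infty,+\infty]$ is convex if its epigraph $\{(z,\mu)\in (X\times X^*)\times\mathbb{R} : h(z)\le\mu\}$ is convex, and proper if its effective domain $D(h)=\{z\in X\times X^* : h(z)<\infty\}$ is nonempty. Let $$\mathcal H=\{h:X\times X^*\to[-\infty,+\infty] \;:\; h \text{ is proper and convex, and } h(x,x^*)\ge\langle x,x^*\rangle \text{ for all } (x,x^*)\in X\times X^*\},$$ ordered pointwise, and let $g$ be a minimal element of $\mathcal H$. Put $\mathrm{Pr}_X D(g)=\{x\in X : \exists\, x^*\in X^*,\ (x,x^*)\in D(g)\}$. If $$\bigcup_{\lambda>0}\lambda\,\mathrm{Pr}_X D(g)$$ is a closed linear subspace of $X$, then there exists a maximal monotone operator $T\subset X\times X^*$ (that is, $\langle x-y,x^*-y^*\rangle\ge0$ for all $(x,x^*),(y,y^*)\in T$, and $T$ is maximal under inclusion among the sets with this property) such that $g=\varphi_T$, where $\varphi_T$ is the Fitzpatrick function of $T$, $$\varphi_T(x,x^*)=\sup_{(y,y^*)\in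 T}\langle x-y,\,y^*-x^*\rangle+\langle x,x^*\rangle .$$ -/

import Mathlib

open scoped Pointwise

/-- The epigraph of an extended-real-valued function. -/
def epigraph {E : Type*} (f : E → EReal) : Set (E × ℝ) :=
  {p | f p.1 ≤ (p.2 : EReal)}

/-- An extended-real-valued function is convex if its epigraph is convex. -/
def IsConvexFun {E : Type*} [AddCommGroup E] [Module ℝ E] (f : E → EReal) : Prop :=
  Convex ℝ (epigraph f)

/-- The effective domain. -/
def effDomain {E : Type*} (f : E → EReal) : Set E :=
  {x | f x < ⊤}

/-- Properness: the effective domain is nonempty. In the family `familyH` below, the value `⊥` is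
excluded by the lower bound. -/
def IsProperFun {E : Type*} (f : E → EReal) : Prop :=
  (effDomain f).Nonempty

section Duality

variable {X : Type*} [NormedAddCommGroup X] [NormedSpace ℝ X]

/-- The duality product `π(x, x*) = x*(x)` on `X × X*`. -/
def dualityProduct (p : X × StrongDual ℝ X) : ℝ :=
  p.2 p.1

/-- A point-to-set operator `X ⇉ X*`, given by its graph, is monotone. -/
def IsMonotoneOperator (T : Set (X × StrongDual ℝ X)) : Prop :=
  ∀ p ∈ T, ∀ q ∈ T, 0 ≤ (p.2 - q.2) (p.1 - q.1)

/-- A maximal monotone operator: maximal under inclusion among the monotone ones. -/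
def IsMaximalMonotone (T : Set (X × StrongDual ℝ X)) : Prop :=
  Maximal IsMonotoneOperator T

/-- The Fitzpatrick function
`φ_T(x, x*) = sup_{(y, y*) ∈ T} ⟨x - y, y* - x*⟩ + ⟨x, x*⟩`. -/
noncomputable def fitzpatrick (T : Set (X × StrongDual ℝ X)) : X × StrongDual ℝ X → EReal :=
  fun p => (⨆ q ∈ T, (((q.2 - p.2) (p.1 - q.1) : ℝ) : EReal)) + ((dualityProduct p : ℝ) : EReal)

variable (X) in
/-- The family of proper convex functions on `X × X*` that majorize the duality product. -/
def familyH : Set (X × StrongDual ℝ X → EReal) :=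
  {h | IsProperFun h ∧ IsConvexFun h ∧ ∀ p, ((dualityProduct p : ℝ) : EReal) ≤ h p}

end Duality

/-! Take `T` to be the set where `g` equals the duality product π. Minimality makes the epigraph of
`g` maximal among convex sets on which π lies below the height, so `g z = π z` exactly when the
conjugate of `g` at the transposed point is at most π. This gives monotonicity of `T` and
`fitzpatrick T ≤ g`. If `T` is maximal, `fitzpatrick T` lies in `familyH X`, and minimality forces
equality.

Maximality is the hard part. Given `(x₀, x₀')` related to `T`, its conjugate inequality is tested
one epigraph point `((y, ys), ν)` at a time. Adding a quadratic in the two directions `x₀`, `y` to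
`g` gives a nonnegative convex problem, whose value function has a subgradient at `0` by a Baire
argument using the domain hypothesis. The subgradient yields a point of `T`
(`exists_coincidence_point`), and relatedness forces that point to be `(x₀, w + x₀')` with `w`
vanishing at `x₀` and `y`; its conjugate inequality at `y` is the one sought. Only finitely many
directions are penalized, so reflexivity is not needed. -/

/-! ### Open mapping and subdifferentiability for convex value functions. -/

section ConvexSeries

variable {E Z : Type*} [NormedAddCommGroup E] [NormedSpace ℝ E]
  [NormedAddCommGroup Z] [NormedSpace ℝ Z]

/-- A closed convex set is stable under infinite convex combinations with dyadic weights. -/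
theorem Convex.mem_of_hasSum_dyadic {D : Set E} (hD : Convex ℝ D) (hcl : IsClosed D)
    {p : ℕ → E} (hp : ∀ k, p k ∈ D) {x : E}
    (hx : HasSum (fun k => ((1 / 2 : ℝ) ^ (k + 1)) • p k) x) : x ∈ D := by
  have key : ∀ N : ℕ, ∀ q ∈ D,
      (∑ k ∈ Finset.range N, ((1 / 2 : ℝ) ^ (k + 1)) • p k) + ((1 / 2 : ℝ) ^ N) • q ∈ D := by
    intro N
    induction N with
    | zero => intro q hq; simpa using hq
    | succ N ih =>
      intro q hq
      have h := ih _ (hD (hp N) hq (by norm_num : (0 : ℝ) ≤ 1 / 2) (by norm_num : (0 : ℝ) ≤ 1 / 2)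
        (by norm_num))
      convert h using 1
      rw [Finset.sum_range_succ]
      module
  have hlim : Filter.Tendsto (fun N : ℕ => (∑ k ∈ Finset.range N, ((1 / 2 : ℝ) ^ (k + 1)) • p k)
      + ((1 / 2 : ℝ) ^ N) • p 0) Filter.atTop (nhds (x + (0 : ℝ) • p 0)) :=
    hx.tendsto_sum_nat.add ((tendsto_pow_atTop_nhds_zero_of_lt_one (by norm_num)
      (by norm_num)).smul_const (p 0))
  rw [zero_smul, add_zero] at hlim
  exact hcl.mem_of_tendsto hlim (Filter.Eventually.of_forall fun N => key N _ (hp 0))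

/-- If the closure of the projection of a closed convex set, bounded in the direction of the
projection, contains a ball centred at the origin, the projection itself contains a smaller one. -/
theorem Convex.ball_subset_image_snd [CompleteSpace Z] {D : Set (Z × E)} (hD : Convex ℝ D)
    (hcl : IsClosed D) {M : ℝ} (hM : ∀ d ∈ D, ‖d.1‖ ≤ M) {r : ℝ} (hr : 0 < r)
    (hball : Metric.ball (0 : E) r ⊆ closure (Prod.snd '' D)) :
    Metric.ball (0 : E) (r / 2) ⊆ Prod.snd '' D := by
  intro u hu
  have hu' : (2 : ℝ) • u ∈ Metric.ball (0 : E) r := by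
    rw [mem_ball_zero_iff] at hu ⊢
    rw [norm_smul, Real.norm_ofNat]; linarith
  have step : ∀ v : Metric.ball (0 : E) r, ∃ d ∈ D, (2 : ℝ) • ((v : E) - d.2) ∈
      Metric.ball (0 : E) r := by
    intro v
    obtain ⟨b, ⟨d, hd, rfl⟩, hb⟩ := Metric.mem_closure_iff.1 (hball v.2) (r / 2) (by linarith)
    refine ⟨d, hd, ?_⟩
    rw [mem_ball_zero_iff, norm_smul, Real.norm_ofNat, ← dist_eq_norm]
    linarith
  choose d hdD hd using step
  -- `v k` is the error left after `k` steps, rescaled by `2 ^ (k + 1)` so that it stays in the ball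
  -- of radius `r`.
  let v : ℕ → Metric.ball (0 : E) r :=
    fun k => Nat.rec (motive := fun _ => Metric.ball (0 : E) r) ⟨(2 : ℝ) • u, hu'⟩
      (fun _ w => ⟨(2 : ℝ) • ((w : E) - (d w).2), hd w⟩) k
  have hv : ∀ k, (v (k + 1)).1 =
    (2 : ℝ) • ((v k).1 - (d (v k)).2) := fun k => rfl
  have hvn : ∀ k, ‖(v k).1‖ ≤ r := fun k =>
    (mem_ball_zero_iff.1 (v k).2).le
  have hpart : ∀ N : ℕ, ∑ k ∈ Finset.range N, ((1 / 2 : ℝ) ^ (k + 1)) • (d (v k)).2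
      = u - ((1 / 2 : ℝ) ^ (N + 1)) • (v N).1 := by
    intro N
    induction N with
    | zero =>
      have : (v 0).1 = (2 : ℝ) • u := rfl
      simp [this, smul_smul]
    | succ N ih =>
      rw [Finset.sum_range_succ, ih, hv N]
      module
  have hgeo : Summable (fun k : ℕ => (1 / 2 : ℝ) ^ (k + 1)) :=
    (summable_nat_add_iff 1).2 (summable_geometric_of_lt_one (by norm_num) (by norm_num))
  have hd2 : ∀ k, ‖(d (v k)).2‖ ≤ 2 * r := by
    intro k
    have h1 : (d (v k)).2 = (v k).1
        - (1 / 2 : ℝ) • (v (k + 1)).1 := by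
      rw [hv k]; module
    rw [h1]
    refine (norm_sub_le _ _).trans ?_
    rw [norm_smul]
    have := hvn k
    have := hvn (k + 1)
    norm_num
    linarith
  have hsnd : HasSum (fun k => ((1 / 2 : ℝ) ^ (k + 1)) • (d (v k)).2) u := by
    refine (hasSum_iff_tendsto_nat_of_summable_norm ?_).2 ?_
    · refine Summable.of_nonneg_of_le (fun _ => norm_nonneg _) (fun k => ?_) (hgeo.mul_right (2 * r))
      rw [norm_smul, Real.norm_of_nonneg (by positivity)]
      exact mul_le_mul_of_nonneg_left (hd2 k) (by positivity)
    · simp_rw [hpart]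
      have : Filter.Tendsto (fun N => ((1 / 2 : ℝ) ^ (N + 1)) • (v N).1)
          Filter.atTop (nhds 0) := by
        have h0 := hgeo.tendsto_atTop_zero.mul_const r
        rw [zero_mul] at h0
        refine squeeze_zero_norm (fun k => ?_) h0
        rw [norm_smul, Real.norm_of_nonneg (by positivity)]
        exact mul_le_mul_of_nonneg_left (hvn k) (by positivity)
      simpa using tendsto_const_nhds.sub this
  have hfst : Summable (fun k => ((1 / 2 : ℝ) ^ (k + 1)) • (d (v k)).1) := by
    refine Summable.of_norm_bounded (hgeo.mul_right M) (fun k => ?_)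
    rw [norm_smul, Real.norm_of_nonneg (by positivity)]
    exact mul_le_mul_of_nonneg_left (hM _ (hdD _)) (by positivity)
  exact ⟨(_, u), hD.mem_of_hasSum_dyadic hcl (fun k => hdD (v k)) (hfst.hasSum.prodMk hsnd), rfl⟩

/-- A value function with closed convex graph and absorbing domain is bounded above near `0`. -/
theorem Convex.exists_ball_bounded_of_absorbing [CompleteSpace E] [CompleteSpace Z]
    {C : Set (Z × E × ℝ)} (hC : Convex ℝ C) (hcl : IsClosed C)
    (hup : ∀ z u μ ν, (z, u, μ) ∈ C → μ ≤ ν → (z, u, ν) ∈ C)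
    (habs : ∀ u : E, ∃ c : ℝ, 0 < c ∧ ∃ z p μ, (z, p, μ) ∈ C ∧ u = c • p) :
    ∃ r : ℝ, 0 < r ∧ ∃ n : ℕ, ∀ u ∈ Metric.ball (0 : E) r, ∃ z, (z, u, (n : ℝ)) ∈ C := by
  -- Truncating the height gives countably many sets for Baire; truncating `‖d.1‖` makes the series
  -- in `Z` converge.
  let D : ℕ → Set (Z × E) := fun n => {d | ‖d.1‖ ≤ n ∧ (d.1, d.2, (n : ℝ)) ∈ C}
  have hDc : ∀ n, Convex ℝ (D n) := by
    intro n x hx y hy a b ha hb hab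
    refine ⟨?_, ?_⟩
    · have := (convex_closedBall (0 : Z) (n : ℝ)) (mem_closedBall_zero_iff.2 hx.1)
        (mem_closedBall_zero_iff.2 hy.1) ha hb hab
      exact mem_closedBall_zero_iff.1 this
    · have := hC hx.2 hy.2 ha hb hab
      convert this using 1
      ext <;> simp
      rw [← add_mul, hab, one_mul]
  have hDcl : ∀ n, IsClosed (D n) := by
    intro n
    have h1 : Continuous fun d : Z × E => (d.1, d.2, (n : ℝ)) := by fun_prop
    exact (isClosed_le (continuous_fst.norm) continuous_const).inter (hcl.preimage h1)
  have hDmono : Monotone D := fun n m hnm d hd =>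
    ⟨hd.1.trans (by exact_mod_cast hnm), hup _ _ _ _ hd.2 (by exact_mod_cast hnm)⟩
  have hDex : ∀ z u μ, (z, u, μ) ∈ C → ∃ n, ∀ m, n ≤ m → (z, u) ∈ D m := by
    intro z u μ h
    obtain ⟨n, hn⟩ := exists_nat_ge (max ‖z‖ μ)
    refine ⟨n, fun m hm => hDmono hm ⟨(le_max_left _ _).trans hn,
      hup _ _ _ _ h ((le_max_right _ _).trans hn)⟩⟩
  obtain ⟨z₀, μ₀, h₀⟩ : ∃ z₀ μ₀, (z₀, (0 : E), μ₀) ∈ C := by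
    obtain ⟨c, hc, z, p, μ, h, h0⟩ := habs 0
    have : p = 0 := by
      rcases smul_eq_zero.1 h0.symm with h | h
      · exact absurd h hc.ne'
      · exact h
    exact ⟨z, μ, this ▸ h⟩
  obtain ⟨n₀, hn₀⟩ := hDex _ _ _ h₀
  -- Dilating by `n + 1` absorbs the factor `c` of `habs`, as convexity with the point over `0`
  -- allows shrinking.
  let f : ℕ → Set E := fun n => {u | ((n : ℝ) + 1)⁻¹ • u ∈ closure (Prod.snd '' D n)}
  have hf : ∀ n, IsClosed (f n) := fun n => isClosed_closure.preimage (by fun_prop)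
  have hcov : ⋃ n, f n = Set.univ := by
    refine Set.eq_univ_of_forall fun u => ?_
    obtain ⟨c, hc, z, p, μ, h, rfl⟩ := habs u
    obtain ⟨n₁, hn₁⟩ := hDex _ _ _ h
    obtain ⟨n₂, hn₂⟩ := exists_nat_ge c
    let n := max n₀ (max n₁ n₂)
    have hcn : c ≤ (n : ℝ) + 1 := by
      have : (n₂ : ℝ) ≤ n := by exact_mod_cast (le_max_right n₁ n₂).trans (le_max_right _ _)
      linarith
    refine Set.mem_iUnion.2 ⟨n, subset_closure ⟨_, hDc n (hn₁ n ((le_max_left _ _).trans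
      (le_max_right _ _))) (hn₀ n (le_max_left _ _)) (a := c / ((n : ℝ) + 1))
      (b := 1 - c / ((n : ℝ) + 1)) (by positivity) ?_ (by ring), ?_⟩⟩
    · rw [sub_nonneg]; exact div_le_one_of_le₀ hcn (by positivity)
    · simp [smul_smul]; congr 1; ring
  obtain ⟨n, hn⟩ := nonempty_interior_of_iUnion_of_closed hf hcov
  obtain ⟨u₀, hu₀⟩ := hn
  obtain ⟨ρ, hρ, hball⟩ := Metric.isOpen_iff.1 isOpen_interior u₀ hu₀
  replace hball := hball.trans interior_subset
  have hn1 : (0 : ℝ) < (n : ℝ) + 1 := by positivity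
  let a : E := ((n : ℝ) + 1)⁻¹ • u₀
  -- The ball from Baire is centred at `a`; averaging it with a point on the ray of `-a` recentres
  -- it at `0`.
  obtain ⟨c, hc, z, p, μ, h, hp⟩ := habs (-a)
  obtain ⟨m, hm⟩ := hDex _ _ _ h
  let N := max n m
  have hcc : Convex ℝ (closure (Prod.snd '' D N)) :=
    ((hDc N).linear_image (LinearMap.snd ℝ Z E)).closure
  have hpN : p ∈ closure (Prod.snd '' D N) := subset_closure ⟨_, hm N (le_max_right _ _), rfl⟩
  have hr : 0 < ρ / (((n : ℝ) + 1) * (1 + c)) := by positivity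
  have hsub : Metric.ball (0 : E) (ρ / (((n : ℝ) + 1) * (1 + c))) ⊆ closure (Prod.snd '' D N) := by
    intro x hx
    have hx' : u₀ + (((n : ℝ) + 1) * (1 + c)) • x ∈ Metric.ball u₀ ρ := by
      rw [mem_ball_zero_iff, lt_div_iff₀ (by positivity)] at hx
      rw [mem_ball_iff_norm, add_sub_cancel_left, norm_smul, Real.norm_of_nonneg (by positivity)]
      linarith
    have h1 : ((n : ℝ) + 1)⁻¹ • (u₀ + (((n : ℝ) + 1) * (1 + c)) • x) ∈ closure (Prod.snd '' D N) :=
      closure_mono (Set.image_mono (hDmono (le_max_left _ _))) (hball hx')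
    have h2 := hcc h1 hpN (a := (1 + c)⁻¹) (b := c * (1 + c)⁻¹) (by positivity) (by positivity)
      (by field_simp)
    convert h2 using 1
    have h3 : (c * (1 + c)⁻¹) • p = (1 + c)⁻¹ • (-a) := by rw [hp, smul_smul, mul_comm]
    rw [h3]
    simp only [a]
    match_scalars
    · field_simp
    · field_simp
      ring
  refine ⟨_, half_pos hr, N, fun u hu => ?_⟩
  obtain ⟨d, hd, rfl⟩ := (hDc N).ball_subset_image_snd (hDcl N) (fun d hd => hd.1) hr hsub hu
  exact ⟨d.1, hd.2⟩

/-- Subdifferentiability at `0` of a value function with closed convex graph and absorbing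
domain. -/
theorem Convex.exists_subgradient_of_absorbing [CompleteSpace E] [CompleteSpace Z]
    {C : Set (Z × E × ℝ)} (hC : Convex ℝ C) (hcl : IsClosed C)
    (hup : ∀ z u μ ν, (z, u, μ) ∈ C → μ ≤ ν → (z, u, ν) ∈ C)
    (habs : ∀ u : E, ∃ c : ℝ, 0 < c ∧ ∃ z p μ, (z, p, μ) ∈ C ∧ u = c • p)
    (hpos : ∀ z μ, (z, (0 : E), μ) ∈ C → 0 ≤ μ) :
    ∃ w : StrongDual ℝ E, ∀ z u μ, (z, u, μ) ∈ C → w u ≤ μ := by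
  obtain ⟨r, hr, n, hn⟩ := hC.exists_ball_bounded_of_absorbing hcl hup habs
  let K : Set (E × ℝ) := Prod.snd '' C
  have hK : Convex ℝ K := hC.linear_image (LinearMap.snd ℝ Z (E × ℝ))
  have hint : ((0 : E), (n : ℝ) + 1) ∈ interior K := by
    refine mem_interior.2 ⟨Metric.ball 0 r ×ˢ Set.Ioi (n : ℝ), ?_,
      Metric.isOpen_ball.prod isOpen_Ioi, ?_⟩
    · rintro ⟨u, μ⟩ ⟨hu, hμ⟩
      obtain ⟨z, hz⟩ := hn u hu
      exact ⟨_, hup _ _ _ _ hz (le_of_lt hμ), rfl⟩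
    · exact ⟨Metric.mem_ball_self hr, by simp⟩
  have h0 : ((0 : E), (0 : ℝ)) ∉ interior K := by
    intro h
    have hcont : Continuous fun ε : ℝ => ((0 : E), -ε) := by fun_prop
    have hev : ∀ᶠ ε in nhds (0 : ℝ), ((0 : E), -ε) ∈ interior K :=
      hcont.continuousAt.eventually (isOpen_interior.mem_nhds (by simpa using h))
    obtain ⟨ε, hε, hε0⟩ :=
      ((hev.filter_mono nhdsWithin_le_nhds).and (self_mem_nhdsWithin (s := Set.Ioi (0 : ℝ)))).exists
    obtain ⟨⟨z, u, μ⟩, hz, he⟩ := interior_subset hε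
    obtain ⟨rfl, rfl⟩ := Prod.mk.inj he
    have := hpos _ _ hz
    have : 0 < ε := hε0
    linarith
  obtain ⟨f, hf⟩ := geometric_hahn_banach_open_point hK.interior isOpen_interior h0
  have hfK : ∀ p ∈ K, f p ≤ 0 := by
    intro p hp
    have hp' : p ∈ closure (interior K) := by
      rw [hK.closure_interior_eq_closure_of_nonempty_interior ⟨_, hint⟩]
      exact subset_closure hp
    refine closure_minimal (fun q hq => ?_) (isClosed_le f.continuous continuous_const) hp'
    have h1 := hf q hq
    have h2 : f ((0 : E), (0 : ℝ)) = 0 := map_zero f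
    rw [h2] at h1
    exact h1.le
  have hsplit : ∀ u μ, f (u, μ) = f (u, 0) + μ * f (0, 1) := by
    intro u μ
    have : ((u, μ) : E × ℝ) = (u, 0) + μ • (0, 1) := by ext <;> simp
    rw [this, map_add, map_smul, smul_eq_mul]
  -- The separating hyperplane is not vertical because `K` has an interior point above `0`.
  have hneg : f (0, 1) < 0 := by
    have h1 := hf _ hint
    have h2 : f ((0 : E), (0 : ℝ)) = 0 := map_zero f
    rw [hsplit, h2] at h1
    have : (0 : ℝ) < n + 1 := by positivity
    by_contra! h
    nlinarith
  refine ⟨(-f (0, 1))⁻¹ • f.comp (ContinuousLinearMap.inl ℝ E ℝ), fun z u μ hz => ?_⟩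
  have h1 := hfK (u, μ) ⟨_, hz, rfl⟩
  rw [hsplit] at h1
  have h2 : 0 < -f (0, 1) := by linarith
  simp only [smul_apply, ContinuousLinearMap.comp_apply,
    ContinuousLinearMap.inl_apply, smul_eq_mul]
  rw [inv_mul_le_iff₀ h2]
  linarith

/-- Subdifferentiability at `0` of a value function with closed convex graph whose domain absorbs
a closed subspace containing it. -/
theorem Convex.exists_subgradient_of_absorbing_submodule [CompleteSpace E] [CompleteSpace Z]
    {C : Set (Z × E × ℝ)} (hC : Convex ℝ C) (hcl : IsClosed C)
    (hup : ∀ z u μ ν, (z, u, μ) ∈ C → μ ≤ ν → (z, u, ν) ∈ C)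
    {W : Submodule ℝ E} (hW : IsClosed (W : Set E)) (hCW : ∀ z u μ, (z, u, μ) ∈ C → u ∈ W)
    (habs : ∀ u ∈ W, ∃ c : ℝ, 0 < c ∧ ∃ z p μ, (z, p, μ) ∈ C ∧ u = c • p)
    (hpos : ∀ z μ, (z, (0 : E), μ) ∈ C → 0 ≤ μ) :
    ∃ w : StrongDual ℝ E, ∀ z u μ, (z, u, μ) ∈ C → w u ≤ μ := by
  have : CompleteSpace W := hW.completeSpace_coe
  let ι : Z × W × ℝ →L[ℝ] Z × E × ℝ :=
    (ContinuousLinearMap.id ℝ Z).prodMap (W.subtypeL.prodMap (ContinuousLinearMap.id ℝ ℝ))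
  obtain ⟨w, hw⟩ := Convex.exists_subgradient_of_absorbing (C := ι ⁻¹' C)
    (hC.linear_preimage ι.toLinearMap) (hcl.preimage ι.continuous)
    (fun z u μ ν h hμ => hup z u μ ν h hμ)
    (fun u => by
      obtain ⟨c, hc, z, p, μ, h, hu⟩ := habs u u.2
      exact ⟨c, hc, z, ⟨p, hCW _ _ _ h⟩, μ, h, Subtype.ext hu⟩)
    (fun z μ h => hpos z μ h)
  obtain ⟨w', hw', -⟩ := _root_.exists_extension_norm_eq W w
  exact ⟨w', fun z u μ h => (hw' ⟨u, hCW _ _ _ h⟩).trans_le (hw z ⟨u, hCW _ _ _ h⟩ μ h)⟩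

end ConvexSeries

/-! ### Minimal functions and their coincidence set with the duality product. -/

section MinimalFunctions

variable {X : Type*} [NormedAddCommGroup X] [NormedSpace ℝ X]

theorem dualityProduct_continuous :
    Continuous (dualityProduct : X × StrongDual ℝ X → ℝ) := by
  unfold dualityProduct
  exact continuous_snd.clm_apply continuous_fst

/-- The function whose epigraph is the vertical closure of a convex set is convex. -/
theorem isConvexFun_iInf {E : Type*} [AddCommGroup E] [Module ℝ E] {K : Set (E × ℝ)}
    (hK : Convex ℝ K) :
    IsConvexFun (fun z => ⨅ (μ : ℝ) (_ : (z, μ) ∈ K), (μ : EReal)) := by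
  have hlt : ∀ z μ ε, (⨅ (ν : ℝ) (_ : (z, ν) ∈ K), (ν : EReal)) ≤ ((μ : ℝ) : EReal) → 0 < ε →
      ∃ ν : ℝ, (z, ν) ∈ K ∧ ν < μ + ε := by
    intro z μ ε h hε
    have h1 : (⨅ (ν : ℝ) (_ : (z, ν) ∈ K), (ν : EReal)) < ((μ + ε : ℝ) : EReal) :=
      h.trans_lt (by exact_mod_cast lt_add_of_pos_right μ hε)
    simp only [iInf_lt_iff] at h1
    obtain ⟨ν, hν, h2⟩ := h1
    exact ⟨ν, hν, by exact_mod_cast h2⟩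
  rintro ⟨z, μ⟩ hz ⟨z', μ'⟩ hz' a b ha hb hab
  refine EReal.le_of_forall_lt_iff_le.1 fun c hc => ?_
  have hc' : a * μ + b * μ' < c := by exact_mod_cast hc
  obtain ⟨ν, hν, h1⟩ := hlt z μ (c - (a * μ + b * μ')) hz (by linarith)
  obtain ⟨ν', hν', h2⟩ := hlt z' μ' (c - (a * μ + b * μ')) hz' (by linarith)
  refine (iInf₂_le (a * ν + b * ν') (hK hν hν' ha hb hab)).trans ?_
  norm_cast
  calc a * ν + b * ν' ≤ a * (μ + (c - (a * μ + b * μ'))) + b * (μ' + (c - (a * μ + b * μ'))) := by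
        gcongr
    _ = (a * μ + b * μ') + (a + b) * (c - (a * μ + b * μ')) := by ring
    _ = c := by rw [hab]; ring

variable {g : X × StrongDual ℝ X → EReal}

/-- The epigraph of a minimal function is maximal among the convex subsets of the epigraph of the
duality product. -/
theorem subset_epigraph_of_minimal (hg : Minimal (fun h => h ∈ familyH X) g)
    {K : Set ((X × StrongDual ℝ X) × ℝ)} (hK : Convex ℝ K) (hgK : epigraph g ⊆ K)
    (hKπ : ∀ p ∈ K, dualityProduct p.1 ≤ p.2) : K ⊆ epigraph g := by
  let h : X × StrongDual ℝ X → EReal := fun z => ⨅ (μ : ℝ) (_ : (z, μ) ∈ K), (μ : EReal)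
  have hle : h ≤ g := fun z => EReal.le_of_forall_lt_iff_le.1 fun μ hμ =>
    iInf₂_le μ (hgK (show g z ≤ μ from hμ.le))
  have hH : h ∈ familyH X := by
    obtain ⟨z, hz⟩ := hg.prop.1
    exact ⟨⟨z, (hle z).trans_lt hz⟩, isConvexFun_iInf hK,
      fun p => le_iInf₂ fun μ hμ => by exact_mod_cast hKπ _ hμ⟩
  exact fun p hp => (hg.le_of_le hH hle p.1).trans (iInf₂_le p.2 hp)

theorem dualityProduct_le_of_mem_epigraph (hg : g ∈ familyH X) :
    ∀ p ∈ epigraph g, dualityProduct p.1 ≤ p.2 := fun p hp => by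
  have h : ((dualityProduct p.1 : ℝ) : EReal) ≤ p.2 := (hg.2.2 p.1).trans hp
  exact_mod_cast h

/-- The closure of the epigraph is convex and, π being continuous, still lies above π. -/
theorem isClosed_epigraph_of_minimal (hg : Minimal (fun h => h ∈ familyH X) g) :
    IsClosed (epigraph g) := by
  refine closure_subset_iff_isClosed.1 (subset_epigraph_of_minimal hg
    (Convex.closure hg.prop.2.1) subset_closure fun p hp => ?_)
  exact closure_minimal (dualityProduct_le_of_mem_epigraph hg.prop)
    (isClosed_le (dualityProduct_continuous.comp continuous_fst) continuous_snd) hp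

/-- The coincidence set of a minimal function with the duality product, in terms of the Fenchel
conjugate: the conjugate lies below the duality product. -/
theorem eq_dualityProduct_of_conjugate_le (hg : Minimal (fun h => h ∈ familyH X) g)
    {z₀ : X × StrongDual ℝ X}
    (h : ∀ p ∈ epigraph g, z₀.2 p.1.1 + p.1.2 z₀.1 - dualityProduct z₀ ≤ p.2) :
    g z₀ = (dualityProduct z₀ : ℝ) := by
  have hne : (epigraph g).Nonempty := by
    obtain ⟨z, hz⟩ := hg.prop.1
    obtain ⟨μ, hμ, -⟩ := EReal.lt_iff_exists_real_btwn.1 (show g z < ⊤ from hz)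
    exact ⟨(z, μ), hμ.le⟩
  have hgc : Convex ℝ (epigraph g) := hg.prop.2.1
  have hK := subset_epigraph_of_minimal hg
    (convex_convexHull ℝ (insert (z₀, dualityProduct z₀) (epigraph g)))
    ((Set.subset_insert _ _).trans (subset_convexHull ℝ _)) ?_
  · exact le_antisymm (hK (subset_convexHull ℝ _ (Set.mem_insert _ _))) (hg.prop.2.2 z₀)
  · intro p hp
    rw [convexHull_insert hne, hgc.convexHull_eq, mem_convexJoin] at hp
    obtain ⟨_, rfl, ⟨z, ν⟩, hz, a, b, ha, hb, hab, rfl⟩ := hp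
    have h1 := h _ hz
    have h2 := dualityProduct_le_of_mem_epigraph hg.prop _ hz
    obtain rfl : a = 1 - b := by linarith
    simp only [dualityProduct, Prod.smul_fst, Prod.smul_snd, Prod.fst_add, Prod.snd_add,
      add_apply, smul_apply, map_add, map_smul, smul_eq_mul] at h1 h2 ⊢
    -- The height minus π is `b * (1 - b)` times the slack in `h1` plus `b ^ 2` times the slack in
    -- `h2`.
    nlinarith [mul_le_mul_of_nonneg_left h1 (mul_nonneg hb ha),
      mul_le_mul_of_nonneg_left h2 (mul_nonneg hb hb)]

/-- On the segment from `(z₀, π z₀)` to an epigraph point, the height exceeds π, with equality at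
the start; dividing by the parameter `b` and letting it tend to `0` gives the bound. -/
theorem conjugate_le_of_eq_dualityProduct (hg : g ∈ familyH X)
    {z₀ : X × StrongDual ℝ X} (h : g z₀ = (dualityProduct z₀ : ℝ)) :
    ∀ p ∈ epigraph g, z₀.2 p.1.1 + p.1.2 z₀.1 - dualityProduct z₀ ≤ p.2 := by
  rintro ⟨z, ν⟩ hz
  have key : ∀ b : ℝ, 0 < b → b ≤ 1 → z₀.2 z.1 + z.2 z₀.1 - dualityProduct z₀
      + b * (z.2 - z₀.2) (z.1 - z₀.1) ≤ ν := by
    intro b hb hb1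
    have h1 := dualityProduct_le_of_mem_epigraph hg _
      (hg.2.1 (show (z₀, dualityProduct z₀) ∈ epigraph g from h.le) hz
        (sub_nonneg.2 hb1) hb.le (by ring))
    simp only [dualityProduct, Prod.smul_fst, Prod.smul_snd, Prod.fst_add, Prod.snd_add,
      add_apply, smul_apply, sub_apply, map_add, map_sub, map_smul, smul_eq_mul] at h1 ⊢
    refine le_of_mul_le_mul_left ?_ hb
    nlinarith
  have hlim : Filter.Tendsto (fun b : ℝ => z₀.2 z.1 + z.2 z₀.1 - dualityProduct z₀
      + b * (z.2 - z₀.2) (z.1 - z₀.1)) (nhdsWithin 0 (Set.Ioi 0))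
      (nhds (z₀.2 z.1 + z.2 z₀.1 - dualityProduct z₀ + 0 * (z.2 - z₀.2) (z.1 - z₀.1))) :=
    ((Continuous.tendsto (by fun_prop) 0)).mono_left nhdsWithin_le_nhds
  rw [zero_mul, add_zero] at hlim
  exact le_of_tendsto hlim (Filter.mem_of_superset (Ioc_mem_nhdsGT zero_lt_one)
    fun b hb => key b hb.1 hb.2)

/-! ### Maximality of the coincidence set. -/

/-- If the domain of a minimal function absorbs a closed subspace, the coincidence set contains a
point `(x₁, w + x₀')` with `x₁ = -(a₁ x₀ + a₂ y)` whose coefficients are coupled with the values of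
`w` at `x₀` and `y`. -/
theorem exists_coincidence_point [CompleteSpace X] (hg : Minimal (fun h => h ∈ familyH X) g)
    {V : Submodule ℝ X} (hV : IsClosed (V : Set X))
    (hdom : (⋃ c : ℝ, ⋃ _ : 0 < c, c • (Prod.fst '' effDomain g)) = (V : Set X))
    (x₀ y : X) (x₀' : StrongDual ℝ X) :
    ∃ (w : StrongDual ℝ X) (a₁ a₂ : ℝ), w x₀ = 1 + a₁ ∧ w y = a₂ ∧
      g (-(a₁ • x₀ + a₂ • y), w + x₀') =
        (dualityProduct (-(a₁ • x₀ + a₂ • y), w + x₀') : ℝ) := by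
  -- With `s₁ = xs x₀`, `s₂ = xs y`, adding the pairing `t₁ * s₁ + t₂ * s₂` to `q` gives half the
  -- sum of the squares of `t₁ - 1 + s₁` and `t₂ + s₂`. This is `hpos`.
  let q : ℝ → ℝ → ℝ → ℝ → ℝ :=
    fun t₁ t₂ s₁ s₂ => (t₁ - 1) ^ 2 / 2 + t₂ ^ 2 / 2 + s₁ ^ 2 / 2 + s₂ ^ 2 / 2 - s₁
  let C : Set ((StrongDual ℝ X × ℝ × ℝ) × (X × ℝ × ℝ) × ℝ) :=
    {p | ((p.1.2.1 • x₀ + p.1.2.2 • y + p.2.1.1, p.1.1 + x₀'),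
      p.2.2 - q p.1.2.1 p.1.2.2 (p.1.1 x₀ + p.2.1.2.1) (p.1.1 y + p.2.1.2.2)
        + x₀' (p.1.2.1 • x₀ + p.1.2.2 • y + p.2.1.1)) ∈ epigraph g}
  have hup' : ∀ z μ ν, (z, μ) ∈ epigraph g → μ ≤ ν → (z, ν) ∈ epigraph g := fun z μ ν h hμ =>
    le_trans (show g z ≤ μ from h) (by exact_mod_cast hμ)
  have hsq : ∀ a b s t : ℝ, 0 ≤ a → 0 ≤ b → a + b = 1 →
      (a * s + b * t) ^ 2 ≤ a * s ^ 2 + b * t ^ 2 := by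
    intro a b s t ha hb hab
    obtain rfl : b = 1 - a := by linarith
    nlinarith [mul_nonneg (mul_nonneg ha hb) (sq_nonneg (s - t))]
  have hC : Convex ℝ C := by
    rintro ⟨⟨xs, t₁, t₂⟩, ⟨u, r₁, r₂⟩, μ⟩ h ⟨⟨xs', t₁', t₂'⟩, ⟨u', r₁', r₂'⟩, μ'⟩ h' a b ha hb hab
    have h1 := hg.prop.2.1 h h' ha hb hab
    have e1 := hsq a b (t₁ - 1) (t₁' - 1) ha hb hab
    have e2 := hsq a b t₂ t₂' ha hb hab
    have e3 := hsq a b (xs x₀ + r₁) (xs' x₀ + r₁') ha hb hab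
    have e4 := hsq a b (xs y + r₂) (xs' y + r₂') ha hb hab
    have e5 : a * (t₁ - 1) + b * (t₁' - 1) = a * t₁ + b * t₁' - 1 := by linear_combination -hab
    rw [e5] at e1
    obtain rfl : b = 1 - a := by linarith
    simp only [C, Set.mem_ofPred_eq]
    refine hup' _ (a * (μ - q t₁ t₂ (xs x₀ + r₁) (xs y + r₂) + x₀' (t₁ • x₀ + t₂ • y + u))
      + (1 - a) * (μ' - q t₁' t₂' (xs' x₀ + r₁') (xs' y + r₂')
        + x₀' (t₁' • x₀ + t₂' • y + u'))) _ ?_ ?_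
    · convert h1 using 1
      ext : 1
      · simp only [Prod.smul_mk, Prod.mk_add_mk]
        ext : 1
        · simp only [smul_eq_mul]; module
        · simp only; module
      · rfl
    · simp only [q, Prod.smul_mk, Prod.mk_add_mk, map_add, map_smul, smul_eq_mul, add_apply,
        smul_apply]
      nlinarith
  have hcl : IsClosed C := by
    refine (isClosed_epigraph_of_minimal hg).preimage ?_
    simp only [q]
    fun_prop
  let F : Submodule ℝ X := Submodule.span ℝ {x₀, y}
  have hF : FiniteDimensional ℝ F := FiniteDimensional.span_of_finite ℝ (by simp)
  have hLF : ∀ t₁ t₂ : ℝ, t₁ • x₀ + t₂ • y ∈ F := fun t₁ t₂ =>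
    F.add_mem (F.smul_mem _ (Submodule.subset_span (by simp)))
      (F.smul_mem _ (Submodule.subset_span (by simp)))
  let W : Submodule ℝ (X × ℝ × ℝ) := (V ⊔ F).comap (LinearMap.fst ℝ X (ℝ × ℝ))
  have hW : IsClosed (W : Set (X × ℝ × ℝ)) :=
    (Submodule.isClosed_sup_finiteDimensional V F hV).preimage continuous_fst
  have hCW : ∀ z u μ, (z, u, μ) ∈ C → u ∈ W := by
    rintro ⟨xs, t₁, t₂⟩ ⟨u, r₁, r₂⟩ μ h
    have h1 : t₁ • x₀ + t₂ • y + u ∈ (V : Set X) := by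
      rw [← hdom]
      refine Set.mem_iUnion₂.2 ⟨1, one_pos, ?_⟩
      rw [one_smul]
      exact ⟨_, lt_of_le_of_lt h (EReal.coe_lt_top _), rfl⟩
    have h2 : u = (t₁ • x₀ + t₂ • y + u) - (t₁ • x₀ + t₂ • y) := by abel
    change u ∈ V ⊔ F
    rw [h2]
    exact Submodule.sub_mem _ (Submodule.mem_sup_left h1) (Submodule.mem_sup_right (hLF _ _))
  have habs : ∀ u ∈ W, ∃ c : ℝ, 0 < c ∧ ∃ z p μ, (z, p, μ) ∈ C ∧ u = c • p := by
    rintro ⟨u, r₁, r₂⟩ hu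
    obtain ⟨v, hv, f, hf, huv⟩ := Submodule.mem_sup.1 (show u ∈ V ⊔ F from hu)
    obtain ⟨t₁, t₂, rfl⟩ := Submodule.mem_span_pair.1 hf
    have hv' : v ∈ (V : Set X) := hv
    rw [← hdom] at hv'
    obtain ⟨c, hc, _, ⟨⟨x, xs⟩, hx, rfl⟩, rfl⟩ := Set.mem_iUnion₂.1 hv'
    obtain ⟨μ, hμ, -⟩ := EReal.lt_iff_exists_real_btwn.1 (show g (x, xs) < ⊤ from hx)
    refine ⟨c, hc, (xs - x₀', -(c⁻¹ * t₁), -(c⁻¹ * t₂)), c⁻¹ • (u, r₁, r₂),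
      μ + q (-(c⁻¹ * t₁)) (-(c⁻¹ * t₂)) ((xs - x₀') x₀ + c⁻¹ * r₁) ((xs - x₀') y + c⁻¹ * r₂)
        - x₀' x, ?_, (smul_inv_smul₀ hc.ne' _).symm⟩
    have hx' : -(c⁻¹ * t₁) • x₀ + -(c⁻¹ * t₂) • y + c⁻¹ • u = x := by
      rw [← huv]
      simp only
      match_scalars <;> field_simp <;> ring
    simp only [C, Set.mem_ofPred_eq, Prod.smul_mk, smul_eq_mul, hx', sub_add_cancel]
    exact hup' _ _ _ hμ.le (by linarith)
  have hpos : ∀ z μ, (z, (0 : X × ℝ × ℝ), μ) ∈ C → 0 ≤ μ := by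
    rintro ⟨xs, t₁, t₂⟩ μ h
    have h1 := dualityProduct_le_of_mem_epigraph hg.prop _ h
    simp only [dualityProduct, q, Prod.fst_zero, Prod.snd_zero, add_zero, add_apply, map_add,
      map_smul, smul_eq_mul] at h1
    nlinarith [sq_nonneg (t₁ - 1 + xs x₀), sq_nonneg (t₂ + xs y)]
  obtain ⟨φ, hφ⟩ := hC.exists_subgradient_of_absorbing_submodule hcl
    (fun z u μ ν h hμ => hup' _ _ _ h (by simp only; linarith)) hW hCW habs hpos
  let w : StrongDual ℝ X := φ.comp (ContinuousLinearMap.inl ℝ X (ℝ × ℝ))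
  let a₁ : ℝ := φ (0, 1, 0)
  let a₂ : ℝ := φ (0, 0, 1)
  have hsplit : ∀ u r₁ r₂, φ (u, r₁, r₂) = w u + r₁ * a₁ + r₂ * a₂ := by
    intro u r₁ r₂
    have : ((u, r₁, r₂) : X × ℝ × ℝ) = (u, 0, 0) + r₁ • (0, 1, 0) + r₂ • (0, 0, 1) := by
      ext <;> simp
    rw [this, map_add, map_add, map_smul, map_smul, smul_eq_mul, smul_eq_mul]
    rfl
  let x₁ : X := -(a₁ • x₀ + a₂ • y)
  have hmain : ∀ p ∈ epigraph g, (w + x₀') p.1.1 + p.1.2 x₁ - dualityProduct (x₁, w + x₀')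
      + ((1 + a₁ - w x₀) ^ 2 + (a₂ - w y) ^ 2) / 2 ≤ p.2 := by
    rintro ⟨⟨x, xs⟩, ν⟩ hp
    -- The `t` and `r` entries are the optimal ones for the quadratic part, with `s₁ = 1 + a₁` and
    -- `s₂ = a₂`.
    have h1 := hφ (xs - x₀', 1 - w x₀, -w y)
      (x - ((1 - w x₀) • x₀ + (-w y) • y), 1 + a₁ - (xs - x₀') x₀, a₂ - (xs - x₀') y)
      (ν + q (1 - w x₀) (-w y) (1 + a₁) a₂ - x₀' x) (by
        simp only [C, Set.mem_ofPred_eq, add_sub_cancel, sub_add_cancel]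
        exact hup' _ _ _ hp (by linarith))
    rw [hsplit] at h1
    simp only [q, dualityProduct, x₁, map_add, map_sub, map_smul, map_neg, smul_eq_mul, add_apply,
      sub_apply] at h1 ⊢
    nlinarith
  have heq : g (x₁, w + x₀') = (dualityProduct (x₁, w + x₀') : ℝ) :=
    eq_dualityProduct_of_conjugate_le hg fun p hp => by
      have := hmain p hp
      have : dualityProduct (x₁, w + x₀') = (w + x₀') x₁ := rfl
      nlinarith [sq_nonneg (1 + a₁ - w x₀), sq_nonneg (a₂ - w y)]
  -- At the point itself both sides reduce to π, so the leftover squares vanish.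
  have hz := hmain ((x₁, w + x₀'), dualityProduct (x₁, w + x₀')) heq.le
  have hπ : dualityProduct (x₁, w + x₀') = (w + x₀') x₁ := rfl
  simp only [hπ] at hz
  have h1 : (1 + a₁ - w x₀) ^ 2 = 0 := by
    nlinarith [sq_nonneg (1 + a₁ - w x₀), sq_nonneg (a₂ - w y)]
  have h2 : (a₂ - w y) ^ 2 = 0 := by
    nlinarith [sq_nonneg (1 + a₁ - w x₀), sq_nonneg (a₂ - w y)]
  refine ⟨w, a₁, a₂, ?_, ?_, heq⟩
  · linarith [pow_eq_zero_iff (two_ne_zero) |>.1 h1]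
  · linarith [pow_eq_zero_iff (two_ne_zero) |>.1 h2]

/-- A point monotonically related to the coincidence set of a minimal function belongs to it. -/
theorem eq_dualityProduct_of_related [CompleteSpace X] (hg : Minimal (fun h => h ∈ familyH X) g)
    {V : Submodule ℝ X} (hV : IsClosed (V : Set X))
    (hdom : (⋃ c : ℝ, ⋃ _ : 0 < c, c • (Prod.fst '' effDomain g)) = (V : Set X))
    {z₀ : X × StrongDual ℝ X}
    (hrel : ∀ z, g z = (dualityProduct z : ℝ) → 0 ≤ (z.2 - z₀.2) (z.1 - z₀.1)) :
    g z₀ = (dualityProduct z₀ : ℝ) := by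
  obtain ⟨x₀, x₀'⟩ := z₀
  refine eq_dualityProduct_of_conjugate_le hg ?_
  rintro ⟨⟨y, ys⟩, ν⟩ hp
  obtain ⟨w, a₁, a₂, h1, h2, heq⟩ := exists_coincidence_point hg hV hdom x₀ y x₀'
  have h3 := hrel _ heq
  -- The pairing in `h3` becomes `-(1 + a₁) ^ 2 - a₂ ^ 2`.
  simp only [add_sub_cancel_right, map_sub, map_neg, map_add, map_smul, smul_eq_mul, h1, h2] at h3
  have ha₁ : a₁ = -1 := by
    have : (1 + a₁) ^ 2 = 0 := by nlinarith [sq_nonneg (1 + a₁), sq_nonneg a₂]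
    linarith [pow_eq_zero_iff (two_ne_zero) |>.1 this]
  have ha₂ : a₂ = 0 := by
    have : a₂ ^ 2 = 0 := by nlinarith [sq_nonneg (1 + a₁), sq_nonneg a₂]
    exact pow_eq_zero_iff (two_ne_zero) |>.1 this
  subst ha₁ ha₂
  have hx : -((-1 : ℝ) • x₀ + (0 : ℝ) • y) = x₀ := by simp
  rw [hx] at heq
  have h4 := conjugate_le_of_eq_dualityProduct hg.prop heq _ hp
  simp only [dualityProduct, add_apply, h1, h2] at h4 ⊢
  linarith

/-! ### Fitzpatrick functions and the conclusion. -/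

/-- The Fitzpatrick function of a maximal monotone operator majorizes the duality product. -/
theorem dualityProduct_le_fitzpatrick {T : Set (X × StrongDual ℝ X)} (hT : IsMaximalMonotone T)
    (p : X × StrongDual ℝ X) : ((dualityProduct p : ℝ) : EReal) ≤ fitzpatrick T p := by
  have h0 : (0 : EReal) ≤ ⨆ q ∈ T, (((q.2 - p.2) (p.1 - q.1) : ℝ) : EReal) := by
    by_cases hex : ∃ q ∈ T, 0 ≤ (q.2 - p.2) (p.1 - q.1)
    · obtain ⟨q, hq, h⟩ := hex
      exact le_trans (by exact_mod_cast h) (le_iSup₂ (f := fun q (_ : q ∈ T) =>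
        (((q.2 - p.2) (p.1 - q.1) : ℝ) : EReal)) q hq)
    -- Otherwise `p` is related to all of `T`, hence in `T` by maximality, and `q = p` gives the
    -- value `0`. This also covers empty `T`.
    · push Not at hex
      have hmono : IsMonotoneOperator (insert p T) := by
        have hneg : ∀ q ∈ T, 0 ≤ (p.2 - q.2) (p.1 - q.1) ∧ 0 ≤ (q.2 - p.2) (q.1 - p.1) := by
          intro q hq
          have := hex q hq
          simp only [sub_apply, map_sub] at this ⊢
          constructor <;> linarith
        rintro a (rfl | ha) b (rfl | hb)
        · simp
        · exact (hneg b hb).1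
        · exact (hneg a ha).2
        · exact hT.prop a ha b hb
      have hp : p ∈ T := hT.le_of_ge hmono (Set.subset_insert _ _) (Set.mem_insert _ _)
      have := hex p hp
      simp at this
  simpa [fitzpatrick] using add_le_add_left h0 ((dualityProduct p : ℝ) : EReal)

/-- Cancelling π at `p` shows `fitzpatrick T` as a supremum of affine functions, matching the
conjugate inequality. -/
theorem fitzpatrick_le_coe_iff {T : Set (X × StrongDual ℝ X)} {p : X × StrongDual ℝ X} {μ : ℝ} :
    fitzpatrick T p ≤ (μ : EReal) ↔ ∀ q ∈ T, q.2 p.1 + p.2 q.1 - dualityProduct q ≤ μ := by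
  have h1 : fitzpatrick T p ≤ (μ : EReal) ↔
      (⨆ q ∈ T, (((q.2 - p.2) (p.1 - q.1) : ℝ) : EReal)) ≤ ((μ - dualityProduct p : ℝ) : EReal) := by
    rw [EReal.coe_sub]
    exact (EReal.le_sub_iff_add_le (by simp) (by simp)).symm
  rw [h1, iSup₂_le_iff]
  refine forall₂_congr fun q _ => ?_
  rw [EReal.coe_le_coe_iff]
  simp only [dualityProduct, sub_apply, map_sub]
  constructor <;> intro h <;> linarith

theorem isConvexFun_fitzpatrick (T : Set (X × StrongDual ℝ X)) : IsConvexFun (fitzpatrick T) := by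
  rintro ⟨z, μ⟩ hz ⟨z', μ'⟩ hz' a b ha hb hab
  refine fitzpatrick_le_coe_iff.2 fun q hq => ?_
  have h1 := mul_le_mul_of_nonneg_left (fitzpatrick_le_coe_iff.1 hz q hq) ha
  have h2 := mul_le_mul_of_nonneg_left (fitzpatrick_le_coe_iff.1 hz' q hq) hb
  simp only [Prod.smul_fst, Prod.smul_snd, Prod.fst_add, Prod.snd_add, add_apply, smul_apply,
    map_add, map_smul, smul_eq_mul] at h1 h2 ⊢
  have h3 : dualityProduct q = a * dualityProduct q + b * dualityProduct q := by
    rw [← add_mul, hab, one_mul]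
  rw [h3]
  linarith

end MinimalFunctions

theorem mainTheorem4 {X : Type*} [NormedAddCommGroup X] [NormedSpace ℝ X] [CompleteSpace X]
    (g : X × StrongDual ℝ X → EReal)
    (hg : Minimal (fun h => h ∈ familyH X) g)
    (hdom : ∃ V : Submodule ℝ X, IsClosed (V : Set X) ∧
      (⋃ c : ℝ, ⋃ _ : 0 < c, c • (Prod.fst '' effDomain g)) = (V : Set X)) :
    ∃ T : Set (X × StrongDual ℝ X), IsMaximalMonotone T ∧ g = fitzpatrick T := by
  obtain ⟨V, hV, hdom⟩ := hdom
  let T : Set (X × StrongDual ℝ X) := {z | g z = (dualityProduct z : ℝ)}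
  have hmono : IsMonotoneOperator T := by
    intro p hp q hq
    have h1 := conjugate_le_of_eq_dualityProduct hg.prop hp (q, dualityProduct q)
      (show g q ≤ _ from le_of_eq hq)
    simp only [dualityProduct, sub_apply, map_sub] at h1 ⊢
    linarith
  have hmax : IsMaximalMonotone T := ⟨hmono, fun S hS hTS z hz =>
    eq_dualityProduct_of_related hg hV hdom fun q hq => hS q (hTS hq) z hz⟩
  have hle : fitzpatrick T ≤ g := fun p => EReal.le_of_forall_lt_iff_le.1 fun μ hμ =>
    fitzpatrick_le_coe_iff.2 fun q hq =>
      conjugate_le_of_eq_dualityProduct hg.prop hq (p, μ) (show g p ≤ μ from hμ.le)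
  obtain ⟨z, hz⟩ := hg.prop.1
  exact ⟨T, hmax, le_antisymm (hg.le_of_le ⟨⟨z, (hle z).trans_lt hz⟩, isConvexFun_fitzpatrick T,
    dualityProduct_le_fitzpatrick hmax⟩ hle) hle⟩
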